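/- Let $B$ be a (not necessarily unital) $C^*$-algebra and let $X$ be a Hilbert $C^*$-module over $B$. Write $\mathrm{End}^*_B(X)$ for the algebra of adjointable operators on $X$. The *$*$-strong module topology* on $\mathrm{End}^*_B(X)$ is the locally convex topology defined by the seminorms $\|T\|_x := \max\{\|Tx\|, \|T^*x\|\}$, $x \in X$. For a submodule $M \subset X$ put $M^\perp := \{y \in X : \langle x, y\rangle = 0 \text{ for all } x \in M\}$; $M$ is *complemented* if $X = M \oplus M^\perp$, and then $P_M \in \mathrm{End}^*_B(X)$ denotes the orthogonal projection onto $M$. A pair $(M,N)$ of complemented submodules is *concordant* if $X = (M\cap N) \oplus \overline{M^\perp + N^\perp}$. **Theorem.** Let $M, N$ be complemented submodules of $X$. Then $(M,N)$ is concordant if and only if the sequence $\big((P_N P_M)^n\big)_{n}$ is Cauchy in the $*$-strong module topology on $\mathrm{End}^*_B(X)$. In that case $M \cap N$ is complemented and the sequence $\big((P_M P_N)^n\big)_n$ converges in the $*$-strong module topology to the projection $P_{M\cap N}$ onto $M \cap N$. -/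

import Mathlib

/-! Hilbert C⋆-modules are Mathlib's `CStarModule B X` (with `X` complete). The scalar action of `B`
is written on the left and the inner product is `B`-linear in its second variable; this is the same
as a right Hilbert C⋆-module over the opposite C⋆-algebra of `B`. -/

namespace HilbertCStar

section General

variable (B : Type*) {X : Type*} [NonUnitalCStarAlgebra B] [PartialOrder B]
  [NormedAddCommGroup X] [NormedSpace ℂ X] [SMul B X] [CStarModule B X]

/-- The orthogonal complement `M^⊥ = {y | ⟨x, y⟩ = 0 for all x ∈ M}`. -/
def orth (M : Submodule ℂ X) : Submodule ℂ X where
  carrier := {y | ∀ x ∈ M, inner B x y = 0}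
  add_mem' := by
    intro a b ha hb x hx
    rw [CStarModule.inner_add_right, ha x hx, hb x hx, add_zero]
  zero_mem' := by
    intro x _
    exact CStarModule.inner_zero_right
  smul_mem' := by
    intro c y hy x hx
    rw [CStarModule.inner_smul_right_complex, hy x hx, smul_zero]

/-- `M` is a complemented `B`-submodule of `X`: it is stable under `B` and `X = M ⊕ M^⊥`.
(Such an `M` is automatically closed, because `M = M^⊥⊥`.) -/
structure IsComplemented (M : Submodule ℂ X) : Prop where
  smul_mem : ∀ (b : B), ∀ x ∈ M, b • x ∈ M
  isCompl : IsCompl M (orth B M)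

/-- The pair `(M, N)` is concordant: `X = (M ∩ N) ⊕ closure (M^⊥ + N^⊥)`. -/
def Concordant (M N : Submodule ℂ X) : Prop :=
  IsCompl (M ⊓ N) (orth B M ⊔ orth B N).topologicalClosure

variable {B} in
theorem ext_inner {y z : X} (h : ∀ x : X, inner B x y = inner B x z) : y = z := by
  rw [← sub_eq_zero, ← CStarModule.inner_self (A := B), CStarModule.inner_sub_right, h, sub_self]

variable (X) in
/-- `End^*_B(X)`, the algebra of adjointable operators on `X`. -/
def adjointableSubalgebra : Subalgebra ℂ (X →L[ℂ] X) where
  carrier := {T | ∃ S : X →L[ℂ] X, ∀ x y, inner B (T x) y = inner B x (S y)}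
  mul_mem' := by
    rintro T₁ T₂ ⟨S₁, h₁⟩ ⟨S₂, h₂⟩
    exact ⟨S₂ * S₁, fun x y => by simp [h₁, h₂]⟩
  add_mem' := by
    rintro T₁ T₂ ⟨S₁, h₁⟩ ⟨S₂, h₂⟩
    exact ⟨S₁ + S₂, fun x y => by simp [h₁, h₂]⟩
  algebraMap_mem' := by
    intro c
    exact ⟨algebraMap ℂ (X →L[ℂ] X) (star c), fun x y => by
      simp [Algebra.algebraMap_eq_smul_one]⟩

variable (X) in
/-- The type of adjointable operators on `X`. -/
abbrev AdjointableEnd : Type _ := adjointableSubalgebra B X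

variable {B}

theorem exists_adjoint (T : AdjointableEnd B X) :
    ∃ S : AdjointableEnd B X, ∀ x y, inner B (T.1 x) y = inner B x (S.1 y) := by
  obtain ⟨T, S, h⟩ := T
  refine ⟨⟨S, T, fun x y => ?_⟩, h⟩
  rw [← CStarModule.star_inner, ← h, CStarModule.star_inner]

/-- The adjoint `T^*`, the unique operator with `⟨T x, y⟩ = ⟨x, T^* y⟩`. -/
noncomputable def adj (T : AdjointableEnd B X) : AdjointableEnd B X :=
  (exists_adjoint T).choose

theorem inner_adj_right (T : AdjointableEnd B X) (x y : X) :
    inner B (T.1 x) y = inner B x ((adj T).1 y) :=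
  (exists_adjoint T).choose_spec x y

theorem adj_eq {T S : AdjointableEnd B X}
    (h : ∀ x y, inner B (T.1 x) y = inner B x (S.1 y)) : adj T = S := by
  ext y
  exact ext_inner (B := B) fun x => by rw [← inner_adj_right, h]

noncomputable instance : StarRing (AdjointableEnd B X) where
  star := adj
  star_involutive T := adj_eq fun x y => by
    rw [← CStarModule.star_inner, ← inner_adj_right, CStarModule.star_inner]
  star_mul S T := adj_eq fun x y => by
    simp [inner_adj_right]
  star_add S T := adj_eq fun x y => by
    simp [inner_adj_right]

noncomputable instance : StarModule ℂ (AdjointableEnd B X) where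
  star_smul c T := adj_eq fun x y => by
    have h : inner B (T.1 x) y = inner B x ((star T).1 y) := inner_adj_right T x y
    simp [h]

/-- The seminorm `‖T‖_x = max {‖T x‖, ‖T^* x‖}` on `End^*_B(X)`. -/
noncomputable def starStrongSeminorm (x : X) : Seminorm ℂ (AdjointableEnd B X) :=
  Seminorm.of (fun T => max ‖T.1 x‖ ‖(star T).1 x‖)
    (fun S T => by
      rw [star_add]
      exact max_le
        ((norm_add_le _ _).trans (add_le_add (le_max_left _ _) (le_max_left _ _)))
        ((norm_add_le _ _).trans (add_le_add (le_max_right _ _) (le_max_right _ _))))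
    (fun c T => by
      rw [star_smul, mul_max_of_nonneg _ _ (norm_nonneg c)]
      congr 1
      · exact norm_smul c (T.1 x)
      · exact (norm_smul (star c) ((star T).1 x)).trans (by rw [norm_star]))

variable (B X) in
/-- The `*`-strong module uniformity (hence topology) on `End^*_B(X)`: the one defined by the
family of seminorms `‖·‖_x`, `x ∈ X`. -/
noncomputable abbrev starStrongUniformSpace : UniformSpace (AdjointableEnd B X) :=
  ⨅ x : X, (starStrongSeminorm (B := B) x).toSeminormedAddCommGroup.toUniformSpace

/-- The sequence `T` is Cauchy in the `*`-strong module topology. -/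
def StarStrongCauchySeq (T : ℕ → AdjointableEnd B X) : Prop :=
  @CauchySeq _ _ (starStrongUniformSpace B X) _ T

/-- The sequence `T` converges to `S` in the `*`-strong module topology. -/
def StarStrongTendsto (T : ℕ → AdjointableEnd B X) (S : AdjointableEnd B X) : Prop :=
  Filter.Tendsto T Filter.atTop (@nhds _ (starStrongUniformSpace B X).toTopologicalSpace S)

theorem inner_projection_left {M : Submodule ℂ X} (h : IsCompl M (orth B M)) (x y : X) :
    inner B (M.projection (orth B M) h x) y = inner B x (M.projection (orth B M) h y) := by
  have key : ∀ a b : X, inner B (M.projection (orth B M) h a) (b - M.projection (orth B M) h b)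
      = 0 := by
    intro a b
    have hb : b - M.projection (orth B M) h b ∈ orth B M := by
      rw [← Submodule.projection_apply_eq_zero_iff h, map_sub,
        Submodule.projection_apply_of_mem_left h (Submodule.projection_apply_mem h b), sub_self]
    exact hb _ (Submodule.projection_apply_mem h a)
  have h₁ := key x y
  have h₂ := congrArg star (key y x)
  rw [CStarModule.star_inner, star_zero] at h₂
  rw [CStarModule.inner_sub_right, sub_eq_zero] at h₁
  rw [CStarModule.inner_sub_left, sub_eq_zero] at h₂
  rw [h₁, h₂]

end General

section Projection

variable {B X : Type*} [NonUnitalCStarAlgebra B] [PartialOrder B] [StarOrderedRing B]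
  [NormedAddCommGroup X] [NormedSpace ℂ X] [SMul B X] [CStarModule B X]

theorem norm_le_norm_add_of_inner_eq_zero {u v : X} (h : inner B u v = 0) : ‖u‖ ≤ ‖u + v‖ := by
  have h' : inner B v u = 0 := by rw [← CStarModule.star_inner, h, star_zero]
  rw [CStarModule.norm_eq_sqrt_norm_inner_self (A := B) u,
    CStarModule.norm_eq_sqrt_norm_inner_self (A := B) (u + v)]
  refine Real.sqrt_le_sqrt (CStarAlgebra.norm_le_norm_of_nonneg_of_le
    CStarModule.inner_self_nonneg ?_)
  simp only [CStarModule.inner_add_right, CStarModule.inner_add_left, h, h', add_zero, zero_add]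
  exact le_add_of_nonneg_right CStarModule.inner_self_nonneg

/-- The projection onto a complemented submodule `M` along `M^⊥`, as a bounded operator. -/
noncomputable def projCLM {M : Submodule ℂ X} (hM : IsComplemented B M) : X →L[ℂ] X :=
  (M.projection (orth B M) hM.isCompl).mkContinuous 1 (fun x => by
    have hx : x - M.projection (orth B M) hM.isCompl x ∈ orth B M := by
      rw [← Submodule.projection_apply_eq_zero_iff hM.isCompl, map_sub,
        Submodule.projection_apply_of_mem_left hM.isCompl
          (Submodule.projection_apply_mem hM.isCompl x), sub_self]
    have := norm_le_norm_add_of_inner_eq_zero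
      (hx _ (Submodule.projection_apply_mem hM.isCompl x))
    rwa [add_sub_cancel, ← one_mul ‖x‖] at this)

/-- The orthogonal projection `P_M ∈ End^*_B(X)` onto a complemented submodule `M`. -/
noncomputable def proj {M : Submodule ℂ X} (hM : IsComplemented B M) : AdjointableEnd B X :=
  ⟨projCLM hM, projCLM hM, fun x y => inner_projection_left hM.isCompl x y⟩

end Projection

end HilbertCStar

namespace HilbertCStar

/-! ### Uniformity of a single seminorm -/

section Seminorm

variable {E : Type*} [AddCommGroup E] [Module ℂ E] (p : Seminorm ℂ E)

/-! Put T = P_N P_M. It fixes M ∩ N and kills M^⊥, so concordance yields pointwise convergence once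
Tⁿ → 0 on N^⊥; contractivity then extends this to the closure of M^⊥ + N^⊥. Under alternating
projections the B-valued squared distances to the next submodule decrease and, by Pythagoras, have
bounded sum, so the n-th is O(1/n) (`nsmul_inner_sub_proj_pow_le`). Cauchy–Schwarz carries this to
Tⁿ on N^⊥ (`norm_mul_proj_pow_sq_le`). Adjoints follow by exchanging M and N. Conversely, a
pointwise limit q of Tⁿx is fixed by T, which forces q ∈ M ∩ N, and x - Tⁿx telescopes inside M^⊥ +
N^⊥ (`concordant_of_cauchySeq_apply`). -/

theorem seminorm_sub_lt_of_cauchySeq {T : ℕ → E}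
    (h : @CauchySeq _ _ p.toSeminormedAddCommGroup.toUniformSpace _ T) {ε : ℝ} (hε : 0 < ε) :
    ∃ K, ∀ m ≥ K, ∀ n ≥ K, p (T m - T n) < ε := by
  let _ := p.toSeminormedAddCommGroup
  obtain ⟨K, hK⟩ := Metric.cauchySeq_iff.1 h ε hε
  refine ⟨K, fun m hm n hn => ?_⟩
  have := hK m hm n hn
  rwa [dist_eq_norm] at this

theorem tendsto_of_seminorm_sub {T : ℕ → E} {S : E}
    (h : Filter.Tendsto (fun n => p (T n - S)) Filter.atTop (nhds 0)) :
    Filter.Tendsto T Filter.atTop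
      (@nhds _ p.toSeminormedAddCommGroup.toUniformSpace.toTopologicalSpace S) := by
  let _ := p.toSeminormedAddCommGroup
  exact tendsto_iff_norm_sub_tendsto_zero.2 h

end Seminorm

/-! ### The `*`-strong topology in terms of pointwise limits -/

section Topology

variable {B X : Type*} [NonUnitalCStarAlgebra B] [PartialOrder B]
  [NormedAddCommGroup X] [NormedSpace ℂ X] [SMul B X] [CStarModule B X]

theorem starStrongSeminorm_apply (x : X) (T : AdjointableEnd B X) :
    starStrongSeminorm x T = max ‖T.1 x‖ ‖(star T).1 x‖ := rfl

/-- Only the `‖T x‖` half of the seminorm is kept: the converse direction never uses the adjoints.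
-/
theorem StarStrongCauchySeq.cauchySeq_apply {T : ℕ → AdjointableEnd B X}
    (hT : StarStrongCauchySeq T) (x : X) : CauchySeq fun n => (T n).1 x := by
  have hx : @CauchySeq _ _
      (starStrongSeminorm (B := B) x).toSeminormedAddCommGroup.toUniformSpace _ T := by
    unfold StarStrongCauchySeq CauchySeq at hT
    rw [cauchy_iInf_uniformSpace'] at hT
    exact hT x
  rw [Metric.cauchySeq_iff]
  intro ε hε
  obtain ⟨K, hK⟩ := seminorm_sub_lt_of_cauchySeq _ hx hε
  refine ⟨K, fun m hm n hn => ?_⟩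
  rw [dist_eq_norm]
  exact (le_max_left _ _).trans_lt (hK m hm n hn)

theorem starStrongTendsto_of_tendsto_apply {T : ℕ → AdjointableEnd B X} {S : AdjointableEnd B X}
    (h : ∀ x, Filter.Tendsto (fun n => (T n).1 x) Filter.atTop (nhds (S.1 x)))
    (h' : ∀ x, Filter.Tendsto (fun n => (star (T n)).1 x) Filter.atTop (nhds ((star S).1 x))) :
    StarStrongTendsto T S := by
  unfold StarStrongTendsto
  rw [UniformSpace.toTopologicalSpace_iInf, nhds_iInf, Filter.tendsto_iInf]
  intro x
  refine tendsto_of_seminorm_sub _ ?_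
  have h₁ := tendsto_iff_norm_sub_tendsto_zero.1 (h x)
  have h₂ := tendsto_iff_norm_sub_tendsto_zero.1 (h' x)
  have h₃ := h₁.max h₂
  rw [max_self] at h₃
  refine h₃.congr fun n => ?_
  rw [starStrongSeminorm_apply, star_sub]
  rfl

theorem StarStrongTendsto.starStrongCauchySeq {T : ℕ → AdjointableEnd B X}
    {S : AdjointableEnd B X} (h : StarStrongTendsto T S) : StarStrongCauchySeq T :=
  @Filter.Tendsto.cauchySeq _ _ (starStrongUniformSpace B X) _ _ _ _ h

theorem pow_succ_apply (T : AdjointableEnd B X) (n : ℕ) (x : X) :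
    (T ^ (n + 1)).1 x = T.1 ((T ^ n).1 x) := by
  rw [pow_succ']
  rfl

theorem orth_anti {L L' : Submodule ℂ X} (h : L ≤ L') : orth B L' ≤ orth B L :=
  fun _ hy x hx => hy x (h hx)

theorem disjoint_orth (L : Submodule ℂ X) : Disjoint L (orth B L) := by
  rw [Submodule.disjoint_def]
  exact fun x hx hx' => CStarModule.inner_self.1 (hx' x hx)

theorem Concordant.symm {M N : Submodule ℂ X} (h : Concordant B M N) : Concordant B N M := by
  unfold Concordant at h ⊢
  rwa [inf_comm, sup_comm]

end Topology

/-! ### Orthogonal projections and their alternating products -/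

section Projection

variable {B X : Type*} [NonUnitalCStarAlgebra B] [PartialOrder B] [StarOrderedRing B]
  [NormedAddCommGroup X] [NormedSpace ℂ X] [SMul B X] [CStarModule B X]
  {M N : Submodule ℂ X} (hM : IsComplemented B M) (hN : IsComplemented B N)

theorem proj_mem (x : X) : (proj hM).1 x ∈ M :=
  Submodule.projection_apply_mem hM.isCompl x

theorem proj_congr (h : M = N) : proj hM = proj hN := by
  subst h
  rfl

theorem proj_of_mem {x : X} (hx : x ∈ M) : (proj hM).1 x = x :=
  Submodule.projection_apply_of_mem_left hM.isCompl hx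

theorem proj_of_mem_orth {x : X} (hx : x ∈ orth B M) : (proj hM).1 x = 0 :=
  (Submodule.projection_apply_eq_zero_iff hM.isCompl).2 hx

theorem sub_proj_mem_orth (x : X) : x - (proj hM).1 x ∈ orth B M := by
  refine (Submodule.projection_apply_eq_zero_iff hM.isCompl).1 ?_
  change (proj hM).1 (x - (proj hM).1 x) = 0
  rw [map_sub, proj_of_mem hM (proj_mem hM x), sub_self]

theorem star_proj : star (proj hM) = proj hM :=
  adj_eq fun x y => inner_projection_left hM.isCompl x y

theorem inner_self_eq_add (x : X) :
    inner B x x = inner B ((proj hM).1 x) ((proj hM).1 x)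
      + inner B (x - (proj hM).1 x) (x - (proj hM).1 x) := by
  have h : inner B ((proj hM).1 x) (x - (proj hM).1 x) = 0 :=
    sub_proj_mem_orth hM x _ (proj_mem hM x)
  have h' : inner B (x - (proj hM).1 x) ((proj hM).1 x) = 0 := by
    rw [← CStarModule.star_inner, h, star_zero]
  calc inner B x x = inner B ((proj hM).1 x + (x - (proj hM).1 x))
        ((proj hM).1 x + (x - (proj hM).1 x)) := by rw [add_sub_cancel]
    _ = _ := by
      rw [CStarModule.inner_add_left, CStarModule.inner_add_right, CStarModule.inner_add_right,
        h, h', add_zero, zero_add]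

theorem inner_proj_self_le (x : X) :
    inner B ((proj hM).1 x) ((proj hM).1 x) ≤ inner B x x := by
  rw [inner_self_eq_add hM x]
  exact le_add_of_nonneg_right CStarModule.inner_self_nonneg

theorem norm_proj_le (x : X) : ‖(proj hM).1 x‖ ≤ ‖x‖ := by
  rw [CStarModule.norm_eq_sqrt_norm_inner_self (A := B) x,
    CStarModule.norm_eq_sqrt_norm_inner_self (A := B)]
  exact Real.sqrt_le_sqrt (CStarAlgebra.norm_le_norm_of_nonneg_of_le
    CStarModule.inner_self_nonneg (inner_proj_self_le hM x))

/-- The distance from `u` to its projection onto `M` is at most its distance to any `w ∈ M`. -/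
theorem inner_sub_proj_le {w : X} (hw : w ∈ M) (u : X) :
    inner B (u - (proj hM).1 u) (u - (proj hM).1 u) ≤ inner B (w - u) (w - u) := by
  have h : u - (proj hM).1 u = -((w - u) - (proj hM).1 (w - u)) := by
    rw [map_sub, proj_of_mem hM hw]
    abel
  rw [h, CStarModule.inner_neg_left, CStarModule.inner_neg_right, neg_neg,
    inner_self_eq_add hM (w - u)]
  exact le_add_of_nonneg_left CStarModule.inner_self_nonneg

theorem mul_proj_apply (x : X) :
    (proj hN * proj hM).1 x = (proj hN).1 ((proj hM).1 x) := rfl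

theorem star_mul_proj_pow (n : ℕ) :
    star ((proj hN * proj hM) ^ n) = (proj hM * proj hN) ^ n := by
  rw [star_pow, star_mul, star_proj, star_proj]

theorem norm_mul_proj_pow_le (n : ℕ) (x : X) : ‖((proj hN * proj hM) ^ n).1 x‖ ≤ ‖x‖ := by
  induction n with
  | zero => exact le_rfl
  | succ n ih =>
    rw [pow_succ_apply, mul_proj_apply]
    exact (norm_proj_le hN _).trans ((norm_proj_le hM _).trans ih)

/-- Pythagoras makes the defects sum to at most `inner B z z`; as they decrease, the last one can
stand in for all `n + 1`. -/
theorem nsmul_inner_sub_proj_pow_le {z : X} (hz : z ∈ M) (n : ℕ) :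
    let w := ((proj hM * proj hN) ^ n).1 z
    w ∈ M ∧ (n + 1) • inner B (w - (proj hN).1 w) (w - (proj hN).1 w)
      + inner B ((proj hN).1 w) ((proj hN).1 w) ≤ inner B z z := by
  induction n with
  | zero =>
    refine ⟨hz, ?_⟩
    rw [zero_add, one_smul, add_comm]
    exact (inner_self_eq_add hN z).ge
  | succ n ih =>
    obtain ⟨hw, ih⟩ := ih
    rw [pow_succ_apply, mul_proj_apply]
    set w := ((proj hM * proj hN) ^ n).1 z
    set u := (proj hN).1 w
    set v := (proj hM).1 u
    refine ⟨proj_mem hM u, ?_⟩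
    -- Best approximation twice: `u ∈ N` competes with `P_N v`, and `w ∈ M` competes with `v = P_M
    -- u`.
    have h₁ : inner B (v - (proj hN).1 v) (v - (proj hN).1 v) ≤ inner B (w - u) (w - u) :=
      (inner_sub_proj_le hN (proj_mem hN w) v).trans (inner_sub_proj_le hM hw u)
    have h₂ : inner B v v ≤ inner B u u := inner_proj_self_le hM u
    rw [inner_self_eq_add hN v] at h₂
    rw [succ_nsmul, add_assoc, add_comm (inner B (v - _) _)]
    exact (add_le_add (nsmul_le_nsmul_right h₁ (n + 1)) h₂).trans ih

theorem norm_sub_proj_pow_sq_le (n : ℕ) (z : X) :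
    let w := ((proj hM * proj hN) ^ (n + 1)).1 z
    (n + 1) * ‖w - (proj hN).1 w‖ ^ 2 ≤ ‖z‖ ^ 2 := by
  intro w
  -- One factor is spent moving an arbitrary `z` into `M`.
  have hw : w = ((proj hM * proj hN) ^ n).1 ((proj hM * proj hN).1 z) := by
    change ((proj hM * proj hN) ^ (n + 1)).1 z = _
    rw [pow_succ]
    rfl
  have hz : (proj hM * proj hN).1 z ∈ M := proj_mem hM _
  have h := (nsmul_inner_sub_proj_pow_le hM hN hz n).2
  rw [← hw] at h
  have h' : (n + 1) • inner B (w - (proj hN).1 w) (w - (proj hN).1 w)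
      ≤ inner B ((proj hM * proj hN).1 z) ((proj hM * proj hN).1 z) :=
    (le_add_of_nonneg_right CStarModule.inner_self_nonneg).trans h
  have h'' := CStarAlgebra.norm_le_norm_of_nonneg_of_le
    (nsmul_nonneg CStarModule.inner_self_nonneg _) h'
  rw [← Nat.cast_smul_eq_nsmul ℝ, norm_smul, ← CStarModule.norm_sq_eq,
    ← CStarModule.norm_sq_eq] at h''
  have hle : ‖(proj hM * proj hN).1 z‖ ≤ ‖z‖ :=
    (norm_proj_le hM _).trans (norm_proj_le hN _)
  rw [Real.norm_natCast, Nat.cast_add, Nat.cast_one] at h''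
  exact h''.trans (pow_le_pow_left₀ (norm_nonneg _) hle 2)

/-- Moving the power to the other side gives `⟨z, z⟩ = ⟨y, w⟩`, and `y ⊥ N` lets `w` be replaced by
its small defect `w - P_N w`. -/
theorem norm_mul_proj_pow_sq_le (n : ℕ) {y : X} (hy : y ∈ orth B N) :
    (n + 1) * ‖((proj hN * proj hM) ^ (n + 1)).1 y‖ ^ 2 ≤ ‖y‖ ^ 2 := by
  set z := ((proj hN * proj hM) ^ (n + 1)).1 y with hz
  set w := ((proj hM * proj hN) ^ (n + 1)).1 z with hw
  have h₁ : inner B z z = inner B y (w - (proj hN).1 w) := by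
    have h₂ : inner B (((proj hN * proj hM) ^ (n + 1)).1 y) z = inner B y
        ((star ((proj hN * proj hM) ^ (n + 1))).1 z) := inner_adj_right _ y z
    have h₃ : inner B y ((proj hN).1 w) = 0 := by
      rw [← CStarModule.star_inner, hy _ (proj_mem hN w), star_zero]
    rw [star_mul_proj_pow] at h₂
    rw [CStarModule.inner_sub_right, h₃, sub_zero]
    exact h₂
  have h₂ : ‖z‖ ^ 2 ≤ ‖y‖ * ‖w - (proj hN).1 w‖ := by
    rw [CStarModule.norm_sq_eq B, h₁]
    exact CStarModule.norm_inner_le X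
  have h₃ : (n + 1) * ‖w - (proj hN).1 w‖ ^ 2 ≤ ‖z‖ ^ 2 := norm_sub_proj_pow_sq_le hM hN n z
  rcases (norm_nonneg z).eq_or_lt with h₀ | h₀
  · rw [← h₀]
    simp
  · refine le_of_mul_le_mul_right ?_ (pow_pos h₀ 2)
    calc (n + 1) * ‖z‖ ^ 2 * ‖z‖ ^ 2 = (n + 1) * (‖z‖ ^ 2) ^ 2 := by ring
      _ ≤ (n + 1) * (‖y‖ * ‖w - (proj hN).1 w‖) ^ 2 := by gcongr
      _ = ‖y‖ ^ 2 * ((n + 1) * ‖w - (proj hN).1 w‖ ^ 2) := by ring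
      _ ≤ ‖y‖ ^ 2 * ‖z‖ ^ 2 := by gcongr

theorem tendsto_mul_proj_pow_of_mem_orth {y : X} (hy : y ∈ orth B N) :
    Filter.Tendsto (fun n => ((proj hN * proj hM) ^ n).1 y) Filter.atTop (nhds 0) := by
  rw [← Filter.tendsto_add_atTop_iff_nat 1, tendsto_zero_iff_norm_tendsto_zero]
  have h : Filter.Tendsto (fun n : ℕ => √(‖y‖ ^ 2 * (1 / ((n : ℝ) + 1)))) Filter.atTop
      (nhds 0) := by
    have := (tendsto_one_div_add_atTop_nhds_zero_nat (𝕜 := ℝ)).const_mul (‖y‖ ^ 2)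
    simpa using this.sqrt
  refine squeeze_zero (fun _ => norm_nonneg _) (fun n => Real.le_sqrt_of_sq_le ?_) h
  rw [mul_one_div, le_div_iff₀ (by positivity), mul_comm]
  exact norm_mul_proj_pow_sq_le hM hN n hy

theorem mul_proj_pow_eq_zero_of_mem_orth {y : X} (hy : y ∈ orth B M) (n : ℕ) :
    ((proj hN * proj hM) ^ (n + 1)).1 y = 0 := by
  rw [pow_succ]
  change ((proj hN * proj hM) ^ n).1 ((proj hN).1 ((proj hM).1 y)) = 0
  rw [proj_of_mem_orth hM hy, map_zero, map_zero]

theorem tendsto_mul_proj_pow_of_mem_closure {y : X}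
    (hy : y ∈ (orth B M ⊔ orth B N).topologicalClosure) :
    Filter.Tendsto (fun n => ((proj hN * proj hM) ^ n).1 y) Filter.atTop (nhds 0) := by
  rw [Metric.tendsto_atTop]
  intro ε hε
  obtain ⟨s, hs, hys⟩ := Metric.mem_closure_iff.1 hy (ε / 2) (half_pos hε)
  obtain ⟨a, ha, b, hb, rfl⟩ := Submodule.mem_sup.1 hs
  obtain ⟨K, hK⟩ := Metric.tendsto_atTop.1 (tendsto_mul_proj_pow_of_mem_orth hM hN hb)
    (ε / 2) (half_pos hε)
  -- The extra 1 makes the exponent positive, so that the power kills `a ∈ M^⊥`.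
  refine ⟨K + 1, fun n hn => ?_⟩
  have hKn := hK n (by omega)
  obtain ⟨m, rfl⟩ : ∃ m, n = m + 1 := ⟨n - 1, by omega⟩
  rw [dist_zero_right] at hKn ⊢
  have hsplit : ((proj hN * proj hM) ^ (m + 1)).1 y
      = ((proj hN * proj hM) ^ (m + 1)).1 (y - (a + b))
        + ((proj hN * proj hM) ^ (m + 1)).1 b := by
    rw [map_sub, map_add, mul_proj_pow_eq_zero_of_mem_orth hM hN ha]
    abel
  rw [hsplit]
  rw [dist_eq_norm] at hys
  have := norm_mul_proj_pow_le hM hN (m + 1) (y - (a + b))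
  have := norm_add_le (((proj hN * proj hM) ^ (m + 1)).1 (y - (a + b)))
    (((proj hN * proj hM) ^ (m + 1)).1 b)
  linarith

theorem mul_proj_pow_of_mem_inf {x : X} (hx : x ∈ M ⊓ N) (n : ℕ) :
    ((proj hN * proj hM) ^ n).1 x = x := by
  induction n with
  | zero => rfl
  | succ n ih => rw [pow_succ_apply, ih, mul_proj_apply, proj_of_mem hM hx.1, proj_of_mem hN hx.2]

theorem isClosed_orth (L : Submodule ℂ X) : IsClosed (orth B L : Set X) := by
  have h : (orth B L : Set X) = ⋂ x ∈ L, {y | inner B x y = 0} := by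
    ext y
    simp only [Set.mem_iInter]
    rfl
  rw [h]
  refine isClosed_biInter fun x _ => isClosed_eq ?_ continuous_const
  exact CStarModule.continuous_inner.comp (Continuous.prodMk_right x)

variable (M N) in
theorem closure_sup_orth_le :
    (orth B M ⊔ orth B N).topologicalClosure ≤ orth B (M ⊓ N) :=
  Submodule.topologicalClosure_minimal _
    (sup_le (orth_anti inf_le_left) (orth_anti inf_le_right)) (isClosed_orth _)

include hM hN in
theorem Concordant.isComplemented_inf (h : Concordant B M N) : IsComplemented B (M ⊓ N) where
  smul_mem b x hx := ⟨hM.smul_mem b x hx.1, hN.smul_mem b x hx.2⟩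
  isCompl := ⟨disjoint_orth _, h.codisjoint.mono_right (closure_sup_orth_le M N)⟩

theorem Concordant.tendsto_mul_proj_pow (h : Concordant B M N)
    (hMN : IsComplemented B (M ⊓ N)) (x : X) :
    Filter.Tendsto (fun n => ((proj hN * proj hM) ^ n).1 x) Filter.atTop
      (nhds ((proj hMN).1 x)) := by
  obtain ⟨a, ha, c, hc, rfl⟩ := Submodule.mem_sup.1
    (h.sup_eq_top.symm ▸ Submodule.mem_top : x ∈ M ⊓ N ⊔ (orth B M ⊔ orth B N).topologicalClosure)
  rw [map_add, proj_of_mem hMN ha, proj_of_mem_orth hMN (closure_sup_orth_le M N hc)]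
  refine (tendsto_const_nhds.add (tendsto_mul_proj_pow_of_mem_closure hM hN hc)).congr fun n => ?_
  rw [map_add, mul_proj_pow_of_mem_inf hM hN ha]

theorem Concordant.starStrongTendsto (h : Concordant B M N)
    (hMN : IsComplemented B (M ⊓ N)) :
    StarStrongTendsto (fun n : ℕ => (proj hN * proj hM) ^ n) (proj hMN) := by
  refine starStrongTendsto_of_tendsto_apply (h.tendsto_mul_proj_pow hM hN hMN) fun x => ?_
  simp only [star_mul_proj_pow, star_proj]
  have hNM : IsComplemented B (N ⊓ M) := inf_comm M N ▸ hMN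
  rw [proj_congr hMN hNM (inf_comm M N)]
  exact h.symm.tendsto_mul_proj_pow hN hM hNM x

/-! ### From Cauchy sequences to concordance -/

theorem mem_of_inner_le_inner_proj {x : X}
    (h : inner B x x ≤ inner B ((proj hM).1 x) ((proj hM).1 x)) : x ∈ M := by
  rw [inner_self_eq_add hM x, add_le_iff_nonpos_right] at h
  have h₀ := CStarModule.inner_self.1 (le_antisymm h CStarModule.inner_self_nonneg)
  rw [sub_eq_zero] at h₀
  rw [h₀]
  exact proj_mem hM x

theorem mem_inf_of_mul_proj_eq {q : X} (hq : (proj hN * proj hM).1 q = q) : q ∈ M ⊓ N := by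
  refine ⟨mem_of_inner_le_inner_proj hM ?_, ?_⟩
  -- Since `q = P_N (P_M q)`, contractivity of `P_N` leaves no room for `P_M` to shorten `q`.
  · conv_lhs => rw [← hq]
    exact inner_proj_self_le hN _
  · rw [← hq]
    exact proj_mem hN _

/-- Each projection changes a vector by an element of the corresponding complement; these changes
add up. -/
theorem sub_mul_proj_pow_mem (n : ℕ) (x : X) :
    x - ((proj hN * proj hM) ^ n).1 x ∈ orth B M ⊔ orth B N := by
  induction n with
  | zero =>
    change x - x ∈ _
    rw [sub_self]
    exact zero_mem _
  | succ n ih =>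
    rw [pow_succ_apply, mul_proj_apply]
    set z := ((proj hN * proj hM) ^ n).1 x
    have h₁ := Submodule.mem_sup_left (T := orth B N) (sub_proj_mem_orth hM z)
    have h₂ := Submodule.mem_sup_right (S := orth B M) (sub_proj_mem_orth hN ((proj hM).1 z))
    convert add_mem ih (add_mem h₁ h₂) using 1
    abel

include hM hN in
theorem concordant_of_cauchySeq_apply [CompleteSpace X]
    (h : ∀ x, CauchySeq fun n => ((proj hN * proj hM) ^ n).1 x) : Concordant B M N := by
  refine ⟨(disjoint_orth _).mono_right (closure_sup_orth_le M N), ?_⟩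
  rw [codisjoint_iff, eq_top_iff]
  intro x _
  obtain ⟨q, hq⟩ := cauchySeq_tendsto_of_complete (h x)
  have hfix : (proj hN * proj hM).1 q = q := by
    refine tendsto_nhds_unique ?_ ((Filter.tendsto_add_atTop_iff_nat 1).2 hq)
    simp only [pow_succ_apply]
    exact ((proj hN * proj hM).1.continuous.tendsto q).comp hq
  have hx : x - q ∈ (orth B M ⊔ orth B N).topologicalClosure :=
    mem_closure_of_tendsto (tendsto_const_nhds.sub hq)
      (Filter.Eventually.of_forall fun n => sub_mul_proj_pow_mem hM hN n x)
  exact Submodule.mem_sup.2 ⟨q, mem_inf_of_mul_proj_eq hM hN hfix, x - q, hx, add_sub_cancel q x⟩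

end Projection

end HilbertCStar

open HilbertCStar in
theorem theorem2p8 {B X : Type*} [NonUnitalCStarAlgebra B] [PartialOrder B] [StarOrderedRing B]
    [NormedAddCommGroup X] [NormedSpace ℂ X] [SMul B X] [CStarModule B X] [CompleteSpace X]
    (M N : Submodule ℂ X) (hM : IsComplemented B M) (hN : IsComplemented B N) :
    (Concordant B M N ↔ StarStrongCauchySeq (fun n : ℕ => (proj hN * proj hM) ^ n)) ∧
    (Concordant B M N →
      ∃ hMN : IsComplemented B (M ⊓ N),
        StarStrongTendsto (fun n : ℕ => (proj hM * proj hN) ^ n) (proj hMN)) := by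
  refine ⟨⟨fun h => ?_, fun h => ?_⟩, fun h => ⟨h.isComplemented_inf hM hN, ?_⟩⟩
  · exact (h.starStrongTendsto hM hN (h.isComplemented_inf hM hN)).starStrongCauchySeq
  · exact concordant_of_cauchySeq_apply hM hN h.cauchySeq_apply
  -- The products here are in the opposite order, hence the swap of `M` and `N`.
  · have hNM := h.symm.isComplemented_inf hN hM
    rw [proj_congr _ hNM (inf_comm M N)]
    exact h.symm.starStrongTendsto hN hM hNM
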